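/- Let $k$ be an algebraically closed field, let $S = k[[\alpha_1,\dots,\alpha_n]]$ with maximal ideal $\mathfrak m$, and let $P = k_{dp}[x_1,\dots,x_n]$ be the divided power polynomials, i.e. the $k$-vector space with basis $x^{[a]}$, $a\in\mathbb N^n$, where $x^{[a]}$ has degree $|a| = \sum a_i$. Let $\langle\cdot,\cdot\rangle\colon S\times P\to k$ be the pairing given by $\langle \sum_b c_b\alpha^b, x^{[a]}\rangle = c_a$, and let $S$ act on $P$ by contraction $\lrcorner$, defined by $\langle \tau,\sigma\lrcorner f\rangle = \langle\tau\sigma,f\rangle$ for all $\tau\in S$ (so $\alpha^a\lrcorner x^{[b]} = x^{[b-a]}$ if $a\le b$ and $0$ otherwise). For $f\in P$ put $\operatorname{Ann}(f) = \{\sigma\in S : \sigma\lrcorner f=0\}$ and $\operatorname{Apolar}(f) = S/\operatorname{Ann}(f)$. Let $P_{\le e}$ be the space of elements of $P$ of degree at most $e$, and let $f_{\ge e}$ be the sum of the homogeneous parts of $f$ of degree at least $e$. For a local Artinian quotient $A = S/I$ with maximal ideal $\mathfrak m_A$ let $H_A(i) = \dim_k \mathfrak m_A^i/\mathfrak m_A^{i+1}$,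 and let its socle degree be the largest $d$ with $\mathfrak m_A^d\ne 0$. For an integer $t\ge 1$, the algebra $A$ (of socle degree $d$) is called $t$-compressed if $H_A(i) = \binom{i+n-1}{i}$ for all $0\le i\le t$ and $H_A(d-1) = n$. Let $G^+$ be the group of $k$-linear automorphisms of $S$ of the form $\sigma\mapsto s\,\varphi(\sigma)$, where $s\in 1+\mathfrak m$ and $\varphi$ is a $k$-algebra automorphism of $S$ with $\varphi(\alpha_i)-\alpha_i\in\mathfrak m^2$ for all $i$. An element $L\in G^+$ acts on $P$ by its transpose $L^\vee$, where $\langle\sigma, L^\vee f\rangle = \langle L\sigma, f\rangle$ for all $\sigma\in S$; let $G^+\cdot f = \{L^\vee f : L\in G^+\}$. **Proposition.** Let $f\in P$ have degree $d\ge 3$, where $\operatorname{char} k = 0$ or $\operatorname{char} k > d$, and suppose that $\operatorname{Apolar}(f)$ is $t$-compressed. If $n=1$, assume moreover that $t\le d-2$. Then $$f + P_{\le t+1}\subseteq G^+\cdot f.$$ In particular $f_{\ge t+2}\in G^+\cdot f$, and $\operatorname{Apolar}(f)\simeq\operatorname{Apolar}(f_{\ge t+2})$ as $k$-algebras. -/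

import Mathlib

noncomputable section

namespace Apolarity

/-- The power series ring `S = k[[α₁, …, αₙ]]`. -/
abbrev S (k : Type*) [Field k] (n : ℕ) : Type _ := MvPowerSeries (Fin n) k

/-- The maximal ideal `𝔪` of `S`. -/
abbrev mS (k : Type*) [Field k] (n : ℕ) : Ideal (S k n) := IsLocalRing.maximalIdeal (S k n)

/-- The divided power polynomials `P = k_dp[x₁, …, xₙ]`, written in the basis of the divided
power monomials `x^[a]`, `a ∈ ℕⁿ`: the value `f a` is the coefficient of `f` at `x^[a]`. -/
abbrev P (k : Type*) [Field k] (n : ℕ) : Type _ := (Fin n →₀ ℕ) →₀ k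

variable {k : Type*} [Field k] {n : ℕ}

/-- The pairing `⟨σ, f⟩` between `S` and `P`, for which the `x^[a]` are dual to the monomials
`α^a`. It identifies `P` with the space of functionals on `S` that vanish on some power
of `𝔪`. -/
def pairing (σ : S k n) (f : P k n) : k :=
  f.sum fun a c => MvPowerSeries.coeff a σ * c

/-- The contraction action of `S` on `P`: `α^a ⌟ x^[b]` is `x^[b - a]` if `a ≤ b`
and `0` otherwise. -/
def contract (σ : S k n) (f : P k n) : P k n :=
  f.sum fun b c => ∑ p ∈ Finset.HasAntidiagonal.antidiagonal b,
    Finsupp.single p.2 (MvPowerSeries.coeff p.1 σ * c)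

theorem contract_zero_left (f : P k n) : contract (0 : S k n) f = 0 := by
  simp [contract]

theorem contract_add_left (σ τ : S k n) (f : P k n) :
    contract (σ + τ) f = contract σ f + contract τ f := by
  simp [contract, add_mul, Finset.sum_add_distrib, Finsupp.sum_add]

theorem pairing_add_right (σ : S k n) (f g : P k n) :
    pairing σ (f + g) = pairing σ f + pairing σ g := by
  unfold pairing
  rw [Finsupp.sum_add_index'] <;> simp [mul_add]

theorem pairing_single (σ : S k n) (a : Fin n →₀ ℕ) (c : k) :
    pairing σ (Finsupp.single a c) = MvPowerSeries.coeff a σ * c := by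
  simp [pairing]

theorem pairing_monomial (a : Fin n →₀ ℕ) (f : P k n) :
    pairing (MvPowerSeries.monomial a (1 : k)) f = f a := by
  classical
  simp only [pairing, MvPowerSeries.coeff_monomial, ite_mul, one_mul, zero_mul]
  rw [Finsupp.sum, Finset.sum_ite_eq' f.support a]
  split_ifs with h
  · rfl
  · exact (Finsupp.notMem_support_iff.mp h).symm

theorem eq_of_pairing_eq {f g : P k n} (h : ∀ σ : S k n, pairing σ f = pairing σ g) :
    f = g := by
  ext a
  rw [← pairing_monomial, ← pairing_monomial, h]

/-- Contraction is the transpose of multiplication. -/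
theorem pairing_contract (τ σ : S k n) (f : P k n) :
    pairing τ (contract σ f) = pairing (τ * σ) f := by
  classical
  have key : ∀ (s : Finset (Fin n →₀ ℕ)) (F : (Fin n →₀ ℕ) → P k n),
      pairing τ (∑ a ∈ s, F a) = ∑ a ∈ s, pairing τ (F a) := fun s F =>
    map_sum (⟨⟨pairing τ, by simp [pairing]⟩, pairing_add_right τ⟩ : P k n →+ k) F s
  have key' : ∀ (s : Finset ((Fin n →₀ ℕ) × (Fin n →₀ ℕ)))
      (F : ((Fin n →₀ ℕ) × (Fin n →₀ ℕ)) → P k n),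
      pairing τ (∑ a ∈ s, F a) = ∑ a ∈ s, pairing τ (F a) := fun s F =>
    map_sum (⟨⟨pairing τ, by simp [pairing]⟩, pairing_add_right τ⟩ : P k n →+ k) F s
  rw [contract, Finsupp.sum, key, pairing, Finsupp.sum]
  refine Finset.sum_congr rfl fun b _ => ?_
  rw [key', mul_comm τ σ, MvPowerSeries.coeff_mul, Finset.sum_mul]
  refine Finset.sum_congr rfl fun p _ => ?_
  rw [pairing_single]
  ring

theorem contract_mul (τ σ : S k n) (f : P k n) :
    contract (τ * σ) f = contract τ (contract σ f) := by
  refine eq_of_pairing_eq fun ρ => ?_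
  rw [pairing_contract, pairing_contract, pairing_contract, mul_assoc]

/-- The apolar ideal `Ann(f) = {σ | σ ⌟ f = 0}`. -/
def Ann (f : P k n) : Ideal (S k n) where
  carrier := {σ | contract σ f = 0}
  zero_mem' := contract_zero_left f
  add_mem' := by
    intro σ τ hσ hτ
    rw [Set.mem_ofPred_eq] at *
    rw [contract_add_left, hσ, hτ, add_zero]
  smul_mem' := by
    intro τ σ hσ
    rw [Set.mem_ofPred_eq] at *
    rw [smul_eq_mul, contract_mul, hσ]
    simp [contract]

/-- The apolar algebra `S / Ann(f)`. -/
abbrev Apolar (f : P k n) : Type _ := S k n ⧸ Ann f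

/-- The degree of `f`: the largest `|a|` such that `x^[a]` occurs in `f`. -/
def deg (f : P k n) : ℕ := f.support.sup Finsupp.degree

variable (k n) in
/-- `P_{≤ e}`: the divided power polynomials of degree at most `e`. -/
def PLE (e : ℕ) : Submodule k (P k n) := Finsupp.supported k k {a | a.degree ≤ e}

/-- `f_{≥ e}`: the sum of the homogeneous parts of `f` of degree at least `e`. -/
def partGE (e : ℕ) (f : P k n) : P k n := f.filter fun a => e ≤ a.degree

/-- For an ideal `I` of `S`, the image of `𝔪` in `S / I`. If `I` is proper this is the
maximal ideal of the local ring `S / I`. -/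
def mQuot (I : Ideal (S k n)) : Ideal (S k n ⧸ I) := (mS k n).map (Ideal.Quotient.mk I)

/-- The Hilbert function `H_A(i) = dim_k 𝔪_A^i / 𝔪_A^(i+1)` of `A = S / I`. -/
def hilbertFunction (I : Ideal (S k n)) (i : ℕ) : ℕ :=
  Module.finrank k (↥(mQuot I ^ i) ⧸ (mQuot I ^ (i + 1)).submoduleOf (mQuot I ^ i))

/-- `d` is the socle degree of `A = S / I`: the largest `i` with `𝔪_A^i ≠ 0`. -/
def IsSocleDegree (I : Ideal (S k n)) (d : ℕ) : Prop := IsGreatest {i | mQuot I ^ i ≠ ⊥} d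

/-- `A = S / I`, of socle degree `d`, is `t`-compressed: `t ≥ 1`, `H_A(i) = H_S(i)` for
`0 ≤ i ≤ t`, and `H_A(d - 1) = H_S(1)`. -/
def IsCompressed (I : Ideal (S k n)) (t : ℕ) : Prop :=
  1 ≤ t ∧ (∀ i ≤ t, hilbertFunction I i = (i + n - 1).choose i) ∧
    ∃ d, IsSocleDegree I d ∧ hilbertFunction I (d - 1) = n

theorem map_mem_pow (φ : S k n ≃ₐ[k] S k n) (j : ℕ) {σ : S k n} (h : σ ∈ mS k n ^ j) :
    φ σ ∈ mS k n ^ j := by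
  have h1 : (mS k n).map (φ : S k n →+* S k n) ≤ mS k n := by
    rw [Ideal.map_le_iff_le_comap]
    intro x hx
    rw [Ideal.mem_comap, IsLocalRing.mem_maximalIdeal, mem_nonunits_iff]
    rw [IsLocalRing.mem_maximalIdeal, mem_nonunits_iff] at hx
    exact fun hu => hx ((MulEquiv.isUnit_map φ).mp hu)
  have h2 := Ideal.mem_map_of_mem (φ : S k n →+* S k n) h
  rw [Ideal.map_pow] at h2
  exact Ideal.pow_right_mono h1 j h2

theorem map_mem (φ : S k n ≃ₐ[k] S k n) {σ : S k n} (h : σ ∈ mS k n) : φ σ ∈ mS k n := by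
  simpa using map_mem_pow φ 1 (σ := σ) (by simpa using h)

variable (k n) in
/-- `Aut⁺(S)`: the automorphisms `φ` of the `k`-algebra `S` with `φ(αᵢ) - αᵢ ∈ 𝔪²`
for all `i`. -/
def AutPlus : Subgroup (S k n ≃ₐ[k] S k n) where
  carrier := {φ | ∀ i, φ (MvPowerSeries.X i) - MvPowerSeries.X i ∈ mS k n ^ 2}
  one_mem' := by intro i; simp
  mul_mem' := by
    intro φ ψ hφ hψ i
    have := (mS k n ^ 2).add_mem (map_mem_pow φ 2 (hψ i)) (hφ i)
    simpa using this
  inv_mem' := by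
    intro φ hφ i
    have := (mS k n ^ 2).neg_mem (map_mem_pow φ⁻¹ 2 (hφ i))
    have h1 : φ⁻¹ (φ (MvPowerSeries.X i)) = MvPowerSeries.X i := φ.symm_apply_apply _
    rwa [map_sub, h1, neg_sub] at this

theorem isUnit_of_sub_one_mem {s : S k n} (hs : s - 1 ∈ mS k n) : IsUnit s := by
  by_contra h
  have h1 : s ∈ mS k n := by rwa [IsLocalRing.mem_maximalIdeal, mem_nonunits_iff]
  have h2 : (1 : S k n) ∈ mS k n := by
    have := (mS k n).sub_mem h1 hs
    simpa using this
  exact (Ideal.ne_top_iff_one _).mp (IsLocalRing.maximalIdeal.isMaximal _).ne_top h2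

variable (k n) in
/-- The group `G⁺ = Aut⁺(S) ⋉ (1 + 𝔪)` inside the group of `k`-linear automorphisms of `S`:
the operators `σ ↦ s · φ(σ)` with `φ ∈ Aut⁺(S)` and `s ∈ 1 + 𝔪`. -/
def GPlus : Subgroup (S k n ≃ₗ[k] S k n) where
  carrier := {L | ∃ φ ∈ AutPlus k n, ∃ s : S k n, s - 1 ∈ mS k n ∧ ∀ σ, L σ = s * φ σ}
  one_mem' := ⟨1, one_mem _, 1, by simp, fun σ => by simp⟩
  mul_mem' := by
    rintro L M ⟨φ, hφ, s, hs, hL⟩ ⟨ψ, hψ, u, hu, hM⟩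
    refine ⟨φ * ψ, mul_mem hφ hψ, s * φ u, ?_, fun σ => ?_⟩
    · have h1 : φ u - 1 ∈ mS k n := by simpa using map_mem φ hu
      have h2 := (mS k n).add_mem ((mS k n).mul_mem_left s h1) hs
      have h3 : s * φ u - 1 = s * (φ u - 1) + (s - 1) := by ring
      rwa [h3]
    · rw [LinearEquiv.mul_apply, hM, hL, map_mul, AlgEquiv.mul_apply, mul_assoc]
  inv_mem' := by
    rintro L ⟨φ, hφ, s, hs, hL⟩
    obtain ⟨u, rfl⟩ := isUnit_of_sub_one_mem hs
    refine ⟨φ⁻¹, inv_mem hφ, φ⁻¹ (↑u⁻¹ : S k n), ?_, fun σ => ?_⟩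
    · have h1 : (↑u⁻¹ : S k n) - 1 ∈ mS k n := by
        have h2 := (mS k n).neg_mem ((mS k n).mul_mem_left (↑u⁻¹ : S k n) hs)
        have h3 : -((↑u⁻¹ : S k n) * (↑u - 1)) = (↑u⁻¹ : S k n) - 1 := by
          rw [mul_sub, Units.inv_mul]; ring
        rwa [h3] at h2
      simpa using map_mem φ⁻¹ h1
    · have hc : ∀ x, φ (φ⁻¹ x) = x := φ.apply_symm_apply
      have hLc : L (L⁻¹ σ) = σ := L.apply_symm_apply σ
      apply L.injective
      rw [hLc, hL, map_mul, hc, hc, ← mul_assoc, Units.mul_inv, one_mul]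

/-- The orbit of `f` under the action of `G⁺` on `P`, in which `L ∈ G⁺` acts by its transpose
`L^∨`, determined by `⟨σ, L^∨ f⟩ = ⟨L σ, f⟩` for all `σ ∈ S`. -/
def orbitPlus (f : P k n) : Set (P k n) :=
  {g | ∃ L ∈ GPlus k n, ∀ σ : S k n, pairing σ g = pairing (L σ) f}

end Apolarity

end

namespace Apolarity

open MvPowerSeries

variable {k : Type*} [Field k] {n : ℕ}

/-! The tangent space to the orbit of `f` consists of the functionals `σ ↦ ⟨sσ + ∑ τᵢ ∂ᵢσ, f⟩` with
`s ∈ 𝔪` and `τᵢ ∈ 𝔪²`. Compressedness enters only through `IsCompressed.contractsToLinearOnlyIn`: if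
`σ ⌟ f` has degree at most one, then `σ ∈ 𝔪^(t+1)`. Indeed `H(d-1) = n` makes `σ` congruent modulo
`Ann f` to an element of `𝔪^(d-1)`, and the maximal values `H(0), …, H(t)` say that no leading form
of degree at most `t` occurs in `Ann f`.

A power series orthogonal to the tangent space therefore has no constant term and has all its
partial derivatives in `𝔪^(t+1)`. It then lies in `𝔪^(t+2)` and kills `P_{≤ t+1}`. By duality the
tangent space contains `P_{≤ t+1}` (`mem_tangentSpace`).

To pass from tangent vectors to the orbit, one exponentiates. The exponential series is truncated at
degree `d`, so its denominators are invertible, and modulo `𝔪^(d+1)` it is an element of `G⁺`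
(`exists_gPlus_sub_truncExp_mem`). It moves `f` to `f + h` up to an error with a smaller degree
bound than `h` (`exists_mem_orbitPlus_of_mem_tangentSpace`). Both properties of `f` used here are
invariant along the orbit, so the error can be removed degree by degree (`add_mem_orbitPlus`). -/

/-! ### Powers of the maximal ideal and the pairing -/

theorem mem_mS_iff {σ : S k n} : σ ∈ mS k n ↔ constantCoeff σ = 0 := by
  rw [IsLocalRing.mem_maximalIdeal, mem_nonunits_iff, isUnit_iff_constantCoeff, isUnit_iff_ne_zero,
    not_not]

theorem X_mem_mS (i : Fin n) : (X i : S k n) ∈ mS k n := by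
  rw [mem_mS_iff, constantCoeff_X]

/-- The part of `σ / αᵢ` coming from the monomials of `σ` whose first variable is `αᵢ`. -/
noncomputable def divFirst (i : Fin n) (σ : S k n) : S k n :=
  fun a => if ∀ j < i, a j = 0 then coeff (a + Finsupp.single i 1) σ else 0

theorem coeff_divFirst (i : Fin n) (σ : S k n) (a : Fin n →₀ ℕ) :
    coeff a (divFirst i σ) = if ∀ j < i, a j = 0 then coeff (a + Finsupp.single i 1) σ else 0 :=
  rfl

theorem sum_X_mul_divFirst {σ : S k n} (h : constantCoeff σ = 0) :
    ∑ i, X i * divFirst i σ = σ := by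
  ext a
  rw [map_sum]
  by_cases ha : a = 0
  · subst ha
    rw [coeff_zero_eq_constantCoeff_apply, h]
    exact Finset.sum_eq_zero fun i _ => coeff_zero_X_mul _ _
  · have hs : a.support.Nonempty := Finsupp.support_nonempty_iff.mpr ha
    have hi0 : a (a.support.min' hs) ≠ 0 := Finsupp.mem_support_iff.mp (a.support.min'_mem hs)
    have hmin : ∀ j, a j ≠ 0 → a.support.min' hs ≤ j := fun j hj =>
      a.support.min'_le j (Finsupp.mem_support_iff.mpr hj)
    generalize a.support.min' hs = i₀ at hi0 hmin
    have hle : ∀ i, a i ≠ 0 → Finsupp.single i 1 ≤ a := fun i hi => by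
      rw [Finsupp.single_le_iff]; exact Nat.one_le_iff_ne_zero.mpr hi
    -- Each nonconstant monomial is counted once, through its first variable `i₀`.
    rw [Finset.sum_eq_single i₀]
    · rw [X, coeff_monomial_mul, if_pos (hle _ hi0), one_mul, coeff_divFirst,
        tsub_add_cancel_of_le (hle _ hi0), if_pos]
      intro j hj
      have : a j = 0 := by
        by_contra hne
        exact absurd (hmin j hne) (not_le.mpr hj)
      simp [this]
    · intro i _ hi
      rw [X, coeff_monomial_mul]
      split_ifs with hia
      · rw [coeff_divFirst, if_neg, mul_zero]
        have hai : a i ≠ 0 := by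
          have := hia i
          rw [Finsupp.single_eq_same] at this
          omega
        intro hall
        have hlt : i₀ < i := lt_of_le_of_ne (hmin i hai) (Ne.symm hi)
        have := hall i₀ hlt
        rw [Finsupp.tsub_apply, Finsupp.single_apply, if_neg hi] at this
        exact hi0 (by simpa using this)
      · rfl
    · simp

/-- The powers of the maximal ideal are the sets of power series of bounded below order. -/
theorem mem_mS_pow_iff {j : ℕ} {σ : S k n} :
    σ ∈ mS k n ^ j ↔ ∀ a : Fin n →₀ ℕ, a.degree < j → coeff a σ = 0 := by
  constructor
  · intro h
    have key : ∀ j : ℕ, ∀ σ ∈ mS k n ^ j, (j : ℕ∞) ≤ σ.order := by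
      intro j
      induction j with
      | zero => simp
      | succ j ih =>
        intro σ h
        rw [pow_succ] at h
        refine Submodule.mul_induction_on h ?_ ?_
        · intro x hx y hy
          refine le_trans ?_ le_order_mul
          push_cast
          exact add_le_add (ih x hx) (one_le_order_iff_constCoeff_eq_zero.mpr (mem_mS_iff.mp hy))
        · intro x y hx hy
          exact le_trans (le_min hx hy) min_order_le_add
    intro a ha
    exact coeff_of_lt_order (lt_of_lt_of_le (by exact_mod_cast ha) (key j σ h))
  · induction j generalizing σ with
    | zero => simp
    | succ j ih =>
      intro h
      have h0 : constantCoeff σ = 0 := by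
        rw [← coeff_zero_eq_constantCoeff_apply]; exact h 0 (by simp)
      rw [← sum_X_mul_divFirst h0, pow_succ']
      refine Ideal.sum_mem _ fun i _ => Ideal.mul_mem_mul (X_mem_mS i) (ih fun a ha => ?_)
      rw [coeff_divFirst]
      split_ifs
      · exact h _ (by simpa using ha)
      · rfl

theorem monomial_mem_mS_pow (a : Fin n →₀ ℕ) (c : k) {j : ℕ} (h : j ≤ a.degree) :
    (monomial a c : S k n) ∈ mS k n ^ j := by
  classical
  rw [mem_mS_pow_iff]
  intro b hb
  rw [coeff_monomial, if_neg]
  rintro rfl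
  omega

theorem sub_truncTotal_mem (e : ℕ) (σ : S k n) :
    σ - (truncTotal e σ : MvPolynomial (Fin n) k) ∈ mS k n ^ e := by
  rw [mem_mS_pow_iff]
  intro a ha
  rw [map_sub, MvPolynomial.coeff_coe, coeff_truncTotal _ ha, sub_self]

/-- A linear map that kills a power of `𝔪` is determined by its values on monomials. -/
theorem linearMap_eq_zero {V : Type*} [AddCommGroup V] [Module k V] (M : S k n →ₗ[k] V) (e : ℕ)
    (h1 : ∀ σ ∈ mS k n ^ e, M σ = 0) (h2 : ∀ a : Fin n →₀ ℕ, M (monomial a 1) = 0) (σ : S k n) :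
    M σ = 0 := by
  have h3 : M ∘ₗ 
      (MvPolynomial.coeToMvPowerSeries.algHom (σ := Fin n) (R := k) k).toLinearMap = 0 := by
    refine MvPolynomial.linearMap_ext fun a => LinearMap.ext_ring ?_
    simpa using h2 a
  have h4 := LinearMap.congr_fun h3 (truncTotal e σ)
  have h5 := h1 _ (sub_truncTotal_mem e σ)
  rw [map_sub, sub_eq_zero] at h5
  rw [h5]
  simpa using h4

/-- The pairing with a fixed `f ∈ P`, as a functional on `S`. -/
def pairingLeft (f : P k n) : S k n →ₗ[k] k where
  toFun σ := pairing σ f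
  map_add' σ τ := by simp [pairing, add_mul, Finsupp.sum_add]
  map_smul' c σ := by simp [pairing, mul_assoc, Finsupp.mul_sum]

@[simp]
theorem pairingLeft_apply (f : P k n) (σ : S k n) : pairingLeft f σ = pairing σ f := rfl

theorem pairing_eq_zero_of_mem {e : ℕ} {f : P k n} (hf : f ∈ PLE k n e) {σ : S k n}
    (hσ : σ ∈ mS k n ^ (e + 1)) : pairing σ f = 0 := by
  refine Finset.sum_eq_zero fun a ha => ?_
  have : a.degree ≤ e := hf ha
  simp only [mem_mS_pow_iff.mp hσ a (by omega), zero_mul]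

/-- The pairing identifies `P` with the functionals on `S` that vanish on some power of `𝔪`. -/
theorem exists_pairing_eq (ℓ : S k n →ₗ[k] k) (e : ℕ) (h : ∀ σ ∈ mS k n ^ e, ℓ σ = 0) :
    ∃ g : P k n, ∀ σ, pairing σ g = ℓ σ := by
  have hfin : {a : Fin n →₀ ℕ | a.degree ≤ e}.Finite := Finsupp.finite_of_degree_le e
  let g : P k n := Finsupp.ofSupportFinite (fun a => ℓ (monomial a 1)) (hfin.subset fun a ha => by
    by_contra hne
    rw [Set.mem_ofPred_eq, not_le] at hne
    exact ha (h _ (monomial_mem_mS_pow a 1 hne.le)))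
  refine ⟨g, fun σ => ?_⟩
  have hg : g ∈ PLE k n e := by
    intro a ha
    by_contra hne
    rw [Set.mem_ofPred_eq, not_le] at hne
    exact (Finsupp.mem_support_iff.mp ha) (h _ (monomial_mem_mS_pow a 1 hne.le))
  have := linearMap_eq_zero (pairingLeft g - ℓ) (e + 1) (fun τ hτ => ?_) (fun a => ?_) σ
  · simpa [sub_eq_zero] using this
  · simp [pairing_eq_zero_of_mem hg hτ, h τ (Ideal.pow_le_pow_right (Nat.le_succ e) hτ)]
  · rw [LinearMap.sub_apply, pairingLeft_apply, pairing_monomial, sub_eq_zero]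
    rfl

/-! ### Order-raising operators and automorphisms close to the identity -/

/-- A `k`-linear operator on `S` that raises orders. -/
def RaisesOrder (N : S k n →ₗ[k] S k n) : Prop :=
  ∀ j, ∀ σ ∈ mS k n ^ j, N σ ∈ mS k n ^ (j + 1)

theorem RaisesOrder.pow {N : S k n →ₗ[k] S k n} (hN : RaisesOrder N) (i : ℕ) {j : ℕ} {σ : S k n}
    (hσ : σ ∈ mS k n ^ j) : (N ^ i) σ ∈ mS k n ^ (j + i) := by
  induction i with
  | zero => simpa using hσ
  | succ i ih => rw [pow_succ', Module.End.mul_apply]; exact hN _ _ ih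

theorem RaisesOrder.pow_mem {N : S k n →ₗ[k] S k n} (hN : RaisesOrder N) (i : ℕ) (σ : S k n) :
    (N ^ i) σ ∈ mS k n ^ i := by
  simpa using hN.pow i (j := 0) (σ := σ) (by simp)

theorem RaisesOrder.neg {N : S k n →ₗ[k] S k n} (hN : RaisesOrder N) : RaisesOrder (-N) :=
  fun j σ hσ => by rw [LinearMap.neg_apply]; exact neg_mem (hN j σ hσ)

theorem eq_zero_of_forall_mem_pow {σ : S k n} (h : ∀ j, σ ∈ mS k n ^ j) : σ = 0 := by
  ext a
  rw [mem_mS_pow_iff.mp (h (a.degree + 1)) a (Nat.lt_succ_self _), map_zero]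

theorem RaisesOrder.injective_id_add {N : S k n →ₗ[k] S k n} (hN : RaisesOrder N) :
    Function.Injective (LinearMap.id + N : S k n →ₗ[k] S k n) := by
  rw [← LinearMap.ker_eq_bot, LinearMap.ker_eq_bot']
  intro σ hσ
  have h1 : σ = -N σ := by
    rw [LinearMap.add_apply, LinearMap.id_apply] at hσ
    exact eq_neg_of_add_eq_zero_left hσ
  refine eq_zero_of_forall_mem_pow fun j => ?_
  induction j with
  | zero => simp
  | succ j ih => rw [h1]; exact neg_mem (hN j σ ih)

theorem RaisesOrder.surjective_id_add {N : S k n →ₗ[k] S k n} (hN : RaisesOrder N) :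
    Function.Surjective (LinearMap.id + N : S k n →ₗ[k] S k n) := by
  intro σ
  -- Partial sums of the Neumann series `∑ (-N)^j σ`. Its limit `ρ` is read off coefficientwise,
  -- since the coefficient at `a` is stable from index `|a| + 1` on.
  let geo : ℕ → S k n := fun e => ∑ j ∈ Finset.range e, ((-N) ^ j) σ
  have hgeo : ∀ e₁ e₂ : ℕ, e₁ ≤ e₂ → geo e₂ - geo e₁ ∈ mS k n ^ e₁ := by
    intro e₁ e₂ h
    rw [← Finset.sum_Ico_eq_sub _ h]
    refine Ideal.sum_mem _ fun j hj => ?_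
    exact Ideal.pow_le_pow_right (Finset.mem_Ico.mp hj).1 (hN.neg.pow_mem j σ)
  let ρ : S k n := fun a => coeff a (geo (a.degree + 1))
  have hρ : ∀ e, ρ - geo e ∈ mS k n ^ e := by
    intro e
    rw [mem_mS_pow_iff]
    intro a ha
    have := mem_mS_pow_iff.mp (hgeo (a.degree + 1) e ha) a (Nat.lt_succ_self _)
    rw [map_sub, sub_eq_zero] at this ⊢
    exact this.symm
  have htel : ∀ e, geo e + N (geo e) - σ ∈ mS k n ^ e := by
    intro e
    have h1 : geo e + N (geo e) = σ - ((-N) ^ e) σ := by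
      induction e with
      | zero => simp [geo]
      | succ e ih =>
        have h2 : geo (e + 1) = geo e + ((-N) ^ e) σ := Finset.sum_range_succ _ _
        rw [h2, map_add, pow_succ', Module.End.mul_apply, LinearMap.neg_apply]
        linear_combination ih
    rw [h1, sub_sub_cancel_left]
    exact neg_mem (hN.neg.pow_mem e σ)
  refine ⟨ρ, ?_⟩
  rw [← sub_eq_zero]
  refine eq_zero_of_forall_mem_pow fun e => ?_
  have h1 := add_mem (add_mem (hρ e) (Ideal.pow_le_pow_right (Nat.le_succ e) (hN e _ (hρ e))))
    (htel e)
  rw [map_sub] at h1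
  convert h1 using 1
  simp only [LinearMap.add_apply, LinearMap.id_apply]
  ring

/-- If `φ σ` had constant term `c ≠ 0`, then `σ - c` would be a unit whose image `φ σ - c` is not
one. -/
theorem algHom_map_mem (φ : S k n →ₐ[k] S k n) {σ : S k n} (h : σ ∈ mS k n) : φ σ ∈ mS k n := by
  rw [mem_mS_iff]
  by_contra hc
  have h1 : IsUnit (σ - algebraMap k (S k n) (constantCoeff (φ σ))) := by
    rw [isUnit_iff_constantCoeff, map_sub, mem_mS_iff.mp h, zero_sub]
    simpa [MvPowerSeries.algebraMap_apply] using hc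
  have h2 := h1.map φ
  rw [map_sub, AlgHom.commutes, isUnit_iff_constantCoeff, map_sub] at h2
  simp [MvPowerSeries.algebraMap_apply] at h2

theorem algHom_map_mem_pow (φ : S k n →ₐ[k] S k n) (j : ℕ) {σ : S k n} (h : σ ∈ mS k n ^ j) :
    φ σ ∈ mS k n ^ j := by
  have h1 : (mS k n).map (φ : S k n →+* S k n) ≤ mS k n :=
    Ideal.map_le_iff_le_comap.mpr fun x hx => algHom_map_mem φ hx
  have h2 := Ideal.mem_map_of_mem (φ : S k n →+* S k n) h
  rw [Ideal.map_pow] at h2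
  exact Ideal.pow_right_mono h1 j h2

theorem algHom_sub_mem (φ : S k n →ₐ[k] S k n) (σ : S k n) : φ σ - σ ∈ mS k n := by
  have h1 : σ - algebraMap k (S k n) (constantCoeff σ) ∈ mS k n := by
    rw [mem_mS_iff]; simp [MvPowerSeries.algebraMap_apply]
  have h2 := sub_mem (algHom_map_mem φ h1) h1
  rwa [map_sub, AlgHom.commutes, sub_sub_sub_cancel_right] at h2

/-- The identity `φ(xy) - xy = (φx - x) φy + x (φy - y)` propagates the bound from the variables to
`𝔪`, and then to `𝔪^j` by induction. -/
theorem algHom_sub_id_raisesOrder (φ : S k n →ₐ[k] S k n)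
    (hφ : ∀ i, φ (X i) - X i ∈ mS k n ^ 2) : RaisesOrder (φ.toLinearMap - LinearMap.id) := by
  have hmul : ∀ x y, φ (x * y) - x * y = (φ x - x) * φ y + x * (φ y - y) := by
    intro x y; rw [map_mul]; ring
  have h1 : ∀ σ ∈ mS k n, φ σ - σ ∈ mS k n ^ 2 := by
    intro σ hσ
    rw [← sum_X_mul_divFirst (mem_mS_iff.mp hσ), map_sum, ← Finset.sum_sub_distrib]
    refine Ideal.sum_mem _ fun i _ => ?_
    rw [hmul]
    refine add_mem (Ideal.mul_mem_right _ _ (hφ i)) ?_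
    rw [pow_two]
    exact Ideal.mul_mem_mul (X_mem_mS i) (algHom_sub_mem φ _)
  intro j
  induction j with
  | zero => intro σ _; simpa using algHom_sub_mem φ σ
  | succ j ih =>
    intro σ hσ
    rw [pow_succ] at hσ
    refine Submodule.mul_induction_on hσ ?_ ?_
    · intro x hx y hy
      have h2 : φ x - x ∈ mS k n ^ (j + 1) := by simpa using ih x hx
      change φ (x * y) - x * y ∈ _
      rw [hmul]
      refine add_mem ?_ ?_
      · rw [pow_succ]; exact Ideal.mul_mem_mul h2 (algHom_map_mem φ hy)
      · rw [add_assoc, pow_add]; exact Ideal.mul_mem_mul hx (h1 y hy)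
    · intro x y hx hy
      rw [map_add]
      exact add_mem hx hy

theorem algHom_bijective (φ : S k n →ₐ[k] S k n) (hφ : ∀ i, φ (X i) - X i ∈ mS k n ^ 2) :
    Function.Bijective φ := by
  have h := algHom_sub_id_raisesOrder φ hφ
  have h1 : ⇑φ = ⇑(LinearMap.id + (φ.toLinearMap - LinearMap.id) : S k n →ₗ[k] S k n) := by
    rw [add_sub_cancel]; rfl
  rw [h1]
  exact ⟨h.injective_id_add, h.surjective_id_add⟩

/-! ### Truncated exponentials and elements of `G⁺` -/

/-- The exponential series of `M`, truncated after the term of degree `d`. -/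
noncomputable def truncExp (d : ℕ) (M : S k n →ₗ[k] S k n) : S k n →ₗ[k] S k n :=
  ∑ i ∈ Finset.range (d + 1), ((i.factorial : k)⁻¹) • M ^ i

theorem truncExp_apply (d : ℕ) (M : S k n →ₗ[k] S k n) (σ : S k n) :
    truncExp d M σ = ∑ i ∈ Finset.range (d + 1), ((i.factorial : k)⁻¹) • (M ^ i) σ := by
  simp [truncExp, LinearMap.sum_apply]

/-- The Leibniz rule for powers of an operator satisfying `L (σ τ) = L σ · τ + σ · D τ`. -/
theorem pow_apply_mul {L D : S k n →ₗ[k] S k n} (hL : ∀ σ τ, L (σ * τ) = L σ * τ + σ * D τ)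
    (N : ℕ) (σ τ : S k n) : (L ^ N) (σ * τ) =
      ∑ p ∈ Finset.HasAntidiagonal.antidiagonal N, N.choose p.1 • ((L ^ p.1) σ * (D ^ p.2) τ) := by
  induction N with
  | zero => simp
  | succ N ih =>
    rw [pow_succ', Module.End.mul_apply, ih, map_sum,
      Finset.sum_antidiagonal_choose_succ_nsmul fun i j => (L ^ i) σ * (D ^ j) τ,
      ← Finset.sum_add_distrib]
    refine Finset.sum_congr rfl fun p hp => ?_
    rw [map_nsmul, hL, pow_succ', pow_succ', Module.End.mul_apply, Module.End.mul_apply, smul_add,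
      add_comm, Nat.choose_symm_of_eq_add (Finset.HasAntidiagonal.mem_antidiagonal.mp hp).symm]

theorem inv_factorial_smul_pow_apply_mul {L D : S k n →ₗ[k] S k n}
    (hL : ∀ σ τ, L (σ * τ) = L σ * τ + σ * D τ) {N : ℕ} (hN : (N.factorial : k) ≠ 0)
    (σ τ : S k n) : ((N.factorial : k)⁻¹) • (L ^ N) (σ * τ) =
      ∑ i ∈ Finset.range (N + 1), (((i.factorial : k)⁻¹) • (L ^ i) σ) *
        ((((N - i).factorial : k)⁻¹) • (D ^ (N - i)) τ) := by
  rw [pow_apply_mul hL, Finset.Nat.sum_antidiagonal_eq_sum_range_succ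
    (fun i j => N.choose i • ((L ^ i) σ * (D ^ j) τ)), Finset.smul_sum]
  refine Finset.sum_congr rfl fun i hi => ?_
  have hi' : i ≤ N := Nat.lt_succ_iff.mp (Finset.mem_range.mp hi)
  -- This identity also shows that `i!` and `(N - i)!` are nonzero in `k`.
  have h1 : (N.choose i : k) * i.factorial * (N - i).factorial = N.factorial := by
    rw [← Nat.choose_mul_factorial_mul_factorial hi', Nat.cast_mul, Nat.cast_mul]
  have h2 : (i.factorial : k) ≠ 0 := by rintro h; rw [h] at h1; simp at h1; exact hN h1.symm
  have h3 : ((N - i).factorial : k) ≠ 0 := by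
    rintro h; rw [h] at h1; simp at h1; exact hN h1.symm
  rw [smul_mul_smul_comm, ← Nat.cast_smul_eq_nsmul k, smul_smul]
  congr 1
  field_simp
  linear_combination h1

/-- This is `exp L (στ) = exp L σ · exp D τ` up to order. The Leibniz rule matches the terms with `i
+ j ≤ d`; the remaining products have `i + j > d`, so they lie in `𝔪^(d+1)`. -/
theorem truncExp_mul_sub_mem {L D : S k n →ₗ[k] S k n}
    (hL : ∀ σ τ, L (σ * τ) = L σ * τ + σ * D τ) (hLr : RaisesOrder L) (hDr : RaisesOrder D)
    {d : ℕ} (hd : (d.factorial : k) ≠ 0) (σ τ : S k n) :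
    truncExp d L (σ * τ) - truncExp d L σ * truncExp d D τ ∈ mS k n ^ (d + 1) := by
  have hfac : ∀ N ≤ d, (N.factorial : k) ≠ 0 := fun N hN h0 => hd <| by
    obtain ⟨c, hc⟩ := Nat.factorial_dvd_factorial hN
    rw [hc, Nat.cast_mul, h0, zero_mul]
  have h1 : truncExp d L (σ * τ) = ∑ i ∈ Finset.range (d + 1), ∑ j ∈ Finset.range (d + 1 - i),
      (((i.factorial : k)⁻¹) • (L ^ i) σ) * (((j.factorial : k)⁻¹) • (D ^ j) τ) := by
    rw [truncExp_apply, ← Finset.sum_range_diag_flip (d + 1) fun i j =>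
      (((i.factorial : k)⁻¹) • (L ^ i) σ) * (((j.factorial : k)⁻¹) • (D ^ j) τ)]
    exact Finset.sum_congr rfl fun N hN => inv_factorial_smul_pow_apply_mul hL
      (hfac N (Nat.lt_succ_iff.mp (Finset.mem_range.mp hN))) σ τ
  rw [h1, truncExp_apply, truncExp_apply, Finset.sum_mul_sum, ← Finset.sum_sub_distrib]
  refine Ideal.sum_mem _ fun i _ => ?_
  rw [← neg_sub, ← Finset.sum_Ico_eq_sub _ (Nat.sub_le _ _)]
  refine neg_mem (Ideal.sum_mem _ fun j hj => ?_)
  have hij : d + 1 ≤ i + j := by have := (Finset.mem_Ico.mp hj).1; omega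
  refine Ideal.pow_le_pow_right hij ?_
  rw [pow_add]
  exact Ideal.mul_mem_mul (Submodule.smul_of_tower_mem _ _ (hLr.pow_mem i σ))
    (Submodule.smul_of_tower_mem _ _ (hDr.pow_mem j τ))

theorem truncExp_map_mem_pow {M : S k n →ₗ[k] S k n} (hM : RaisesOrder M) (d : ℕ) {j : ℕ}
    {σ : S k n} (hσ : σ ∈ mS k n ^ j) : truncExp d M σ ∈ mS k n ^ j := by
  rw [truncExp_apply]
  exact Ideal.sum_mem _ fun i _ => Submodule.smul_of_tower_mem _ _
    (Ideal.pow_le_pow_right (Nat.le_add_right j i) (hM.pow i hσ))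

theorem truncExp_sub_self_mem {M : S k n →ₗ[k] S k n} (hM : RaisesOrder M) (d : ℕ) {j : ℕ}
    {σ : S k n} (hσ : σ ∈ mS k n ^ j) : truncExp d M σ - σ ∈ mS k n ^ (j + 1) := by
  rw [truncExp_apply, Finset.sum_range_succ']
  simp only [Nat.factorial_zero, Nat.cast_one, inv_one, pow_zero, one_smul, Module.End.one_apply,
    add_sub_cancel_right]
  exact Ideal.sum_mem _ fun i _ => Submodule.smul_of_tower_mem _ _
    (Ideal.pow_le_pow_right (by omega) (hM.pow (i + 1) hσ))

/-- The truncated exponential of an order raising derivation agrees, up to high order, with an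
automorphism. -/
theorem exists_autPlus_sub_truncExp_mem (D : Derivation k (S k n) (S k n))
    (hD : RaisesOrder (D : S k n →ₗ[k] S k n)) {d : ℕ} (hd : (d.factorial : k) ≠ 0) :
    ∃ φ ∈ AutPlus k n, ∀ σ, φ σ - truncExp d (D : S k n →ₗ[k] S k n) σ ∈ mS k n ^ (d + 1) := by
  set E := truncExp d (D : S k n →ₗ[k] S k n) with hE
  have hX : ∀ i, E (X i) - X i ∈ mS k n ^ 2 := fun i =>
    truncExp_sub_self_mem hD d (j := 1) (by rw [pow_one]; exact X_mem_mS i)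
  have hsub : HasSubst fun i => E (X i) := hasSubst_of_constantCoeff_zero fun i => by
    rw [← mem_mS_iff, ← pow_one (mS k n)]
    exact truncExp_map_mem_pow hD d (by rw [pow_one]; exact X_mem_mS i)
  -- `E` is multiplicative only modulo `𝔪^(d+1)`, so the genuine automorphism is the substitution
  -- `αᵢ ↦ E αᵢ`. The two are compared on monomials, then on all of `S` modulo `𝔪^(d+1)`.
  let φ : S k n →ₐ[k] S k n := substAlgHom hsub
  have hφX : ∀ i, φ (X i) = E (X i) := fun i => substAlgHom_X hsub i
  have hφ2 : ∀ i, φ (X i) - X i ∈ mS k n ^ 2 := fun i => by rw [hφX]; exact hX i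
  have hmulE : ∀ σ τ, E (σ * τ) - E σ * E τ ∈ mS k n ^ (d + 1) := fun σ τ =>
    truncExp_mul_sub_mem (fun a b => by
      simp only [Derivation.coeFn_coe, Derivation.leibniz, smul_eq_mul]; ring) hD hD hd σ τ
  have hmul : ∀ σ τ, φ σ - E σ ∈ mS k n ^ (d + 1) → φ τ - E τ ∈ mS k n ^ (d + 1) →
      φ (σ * τ) - E (σ * τ) ∈ mS k n ^ (d + 1) := by
    intro σ τ h1 h2
    have h3 := sub_mem (add_mem (Ideal.mul_mem_right (φ τ) _ h1) (Ideal.mul_mem_left _ (E σ) h2))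
      (hmulE σ τ)
    convert h3 using 1
    rw [map_mul]
    ring
  have hone : φ 1 - E 1 ∈ mS k n ^ (d + 1) := by
    have : E 1 = 1 := by
      rw [hE, truncExp_apply, Finset.sum_range_succ', Finset.sum_eq_zero]
      · simp
      · intro i _
        rw [pow_succ, Module.End.mul_apply]
        simp
    rw [this, map_one, sub_self]
    exact zero_mem _
  have hmon : ∀ a : Fin n →₀ ℕ, φ (monomial a 1) - E (monomial a 1) ∈ mS k n ^ (d + 1) := by
    intro a
    induction a using Finsupp.induction_linear with
    | zero => rwa [monomial_zero_one]
    | add a b ha hb =>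
      have : (monomial (a + b) 1 : S k n) = monomial a 1 * monomial b 1 := by
        rw [monomial_mul_monomial, one_mul]
      rw [this]
      exact hmul _ _ ha hb
    | single i m =>
      rw [← X_pow_eq]
      induction m with
      | zero => rwa [pow_zero]
      | succ m ih =>
        rw [pow_succ]
        refine hmul _ _ ih ?_
        rw [hφX, sub_self]
        exact zero_mem _
  refine ⟨AlgEquiv.ofBijective φ (algHom_bijective φ hφ2), hφ2, fun σ => ?_⟩
  have h0 := linearMap_eq_zero
    ((Submodule.mkQ ((mS k n ^ (d + 1)).restrictScalars k)) ∘ₗ (φ.toLinearMap - E)) (d + 1)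
    (fun τ hτ => ?_) (fun a => ?_) σ
  · simpa [Submodule.Quotient.mk_eq_zero, -Submodule.Quotient.mk_sub] using h0
  · simpa [Submodule.Quotient.mk_eq_zero, -Submodule.Quotient.mk_sub] using
      sub_mem (algHom_map_mem_pow φ _ hτ) (truncExp_map_mem_pow hD d hτ)
  · simpa [Submodule.Quotient.mk_eq_zero, -Submodule.Quotient.mk_sub] using hmon a

/-- The truncated exponential of `σ ↦ s σ + D σ` agrees, up to high order, with an element
of `G⁺`. -/
theorem exists_gPlus_sub_truncExp_mem (s : S k n) (hs : s ∈ mS k n)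
    (D : Derivation k (S k n) (S k n)) (hD : RaisesOrder (D : S k n →ₗ[k] S k n)) {d : ℕ}
    (hd : (d.factorial : k) ≠ 0) :
    RaisesOrder (LinearMap.mulLeft k s + (D : S k n →ₗ[k] S k n)) ∧ ∃ L ∈ GPlus k n, ∀ σ,
      L σ - truncExp d (LinearMap.mulLeft k s + (D : S k n →ₗ[k] S k n)) σ ∈ mS k n ^ (d + 1) := by
  have hr : RaisesOrder (LinearMap.mulLeft k s + (D : S k n →ₗ[k] S k n)) := by
    intro j σ hσ
    refine add_mem ?_ (hD j σ hσ)
    rw [LinearMap.mulLeft_apply, pow_succ']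
    exact Ideal.mul_mem_mul hs hσ
  refine ⟨hr, ?_⟩
  obtain ⟨φ, hφ, hφE⟩ := exists_autPlus_sub_truncExp_mem D hD hd
  set M : S k n →ₗ[k] S k n := LinearMap.mulLeft k s + (D : S k n →ₗ[k] S k n) with hM
  -- The factor `s` of the element of `G⁺` is the value of the exponential at `1`, as `exp M (1 ·
  -- σ)` is `exp M 1 · exp D σ` up to order `d + 1`.
  have hu : truncExp d M 1 - 1 ∈ mS k n := by
    simpa using truncExp_sub_self_mem hr d (j := 0) (σ := 1) (by simp)
  obtain ⟨u, hu'⟩ := isUnit_of_sub_one_mem hu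
  have hbij : Function.Bijective
      (LinearMap.mulLeft k (u : S k n) ∘ₗ (φ : S k n →ₐ[k] S k n).toLinearMap) := by
    rw [LinearMap.coe_comp]
    exact (Units.mulLeft_bijective u).comp φ.bijective
  refine ⟨LinearEquiv.ofBijective _ hbij, ⟨φ, hφ, u, by rwa [hu'], fun σ => rfl⟩, fun σ => ?_⟩
  have h1 : truncExp d M (1 * σ) - truncExp d M 1 * truncExp d (D : S k n →ₗ[k] S k n) σ ∈
      mS k n ^ (d + 1) :=
    truncExp_mul_sub_mem (fun a b => by
      simp only [hM, LinearMap.add_apply, LinearMap.mulLeft_apply, Derivation.coeFn_coe,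
        Derivation.leibniz, smul_eq_mul]
      ring) hr hD hd 1 σ
  have h2 := sub_mem (Ideal.mul_mem_left _ (u : S k n) (hφE σ)) h1
  rw [one_mul, ← hu'] at h2
  convert h2 using 1
  rw [LinearEquiv.ofBijective_apply, LinearMap.comp_apply, LinearMap.mulLeft_apply]
  change u * φ σ - _ = _
  ring

/-! ### Properties invariant along the orbit -/

theorem orbitPlus_trans {f g h : P k n} (hg : g ∈ orbitPlus f) (hh : h ∈ orbitPlus g) :
    h ∈ orbitPlus f := by
  obtain ⟨L, hL, hLp⟩ := hg
  obtain ⟨M, hM, hMp⟩ := hh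
  exact ⟨L * M, mul_mem hL hM, fun σ => by rw [hMp, hLp]; rfl⟩

/-- Elements of the orbit of `f` have the form `σ ↦ ⟨s φ(σ), f⟩` as functionals on `S`. -/
theorem exists_of_mem_orbitPlus {f g : P k n} (hg : g ∈ orbitPlus f) :
    ∃ (φ : S k n ≃ₐ[k] S k n) (s : (S k n)ˣ), ∀ σ, pairing σ g = pairing ((s : S k n) * φ σ) f := by
  obtain ⟨L, ⟨φ, -, s, hs, hL⟩, hLp⟩ := hg
  obtain ⟨u, rfl⟩ := isUnit_of_sub_one_mem hs
  exact ⟨φ, u, fun σ => by rw [hLp, hL]⟩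

/-- `f` has degree less than `e`, as a functional on `S`. -/
def VanishesOnPow (f : P k n) (e : ℕ) : Prop := ∀ σ ∈ mS k n ^ e, pairing σ f = 0

/-- Every `σ ∈ S` for which `σ ⌟ f` has degree at most one lies in `𝔪^e`. -/
def ContractsToLinearOnlyIn (f : P k n) (e : ℕ) : Prop :=
  ∀ σ : S k n, (∀ τ ∈ mS k n ^ 2, pairing (τ * σ) f = 0) → σ ∈ mS k n ^ e

theorem VanishesOnPow.of_mem_orbitPlus {f g : P k n} (hg : g ∈ orbitPlus f) {e : ℕ}
    (hf : VanishesOnPow f e) : VanishesOnPow g e := by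
  obtain ⟨φ, s, h⟩ := exists_of_mem_orbitPlus hg
  intro σ hσ
  rw [h]
  exact hf _ (Ideal.mul_mem_left _ _ (map_mem_pow φ e hσ))

theorem ContractsToLinearOnlyIn.of_mem_orbitPlus {f g : P k n} (hg : g ∈ orbitPlus f) {e : ℕ}
    (hf : ContractsToLinearOnlyIn f e) : ContractsToLinearOnlyIn g e := by
  obtain ⟨φ, s, h⟩ := exists_of_mem_orbitPlus hg
  intro σ hσ
  have h1 : φ σ ∈ mS k n ^ e := hf _ fun τ hτ => by
    have h2 := hσ (φ.symm (↑s⁻¹ * τ)) (map_mem_pow φ.symm 2 (Ideal.mul_mem_left _ _ hτ))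
    rwa [h, map_mul, AlgEquiv.apply_symm_apply, ← mul_assoc, ← mul_assoc, Units.mul_inv,
      one_mul] at h2
  simpa using map_mem_pow φ.symm e h1

theorem mem_Ann_iff {f : P k n} {σ : S k n} : σ ∈ Ann f ↔ ∀ τ, pairing (τ * σ) f = 0 := by
  change contract σ f = 0 ↔ _
  simp only [← pairing_contract]
  constructor
  · intro h τ
    rw [h]
    simp [pairing]
  · intro h
    exact eq_of_pairing_eq fun τ => by rw [h]; simp [pairing]

theorem apolar_algEquiv_of_mem_orbitPlus {f g : P k n} (hg : g ∈ orbitPlus f) :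
    Nonempty (Apolar f ≃ₐ[k] Apolar g) := by
  obtain ⟨φ, s, h⟩ := exists_of_mem_orbitPlus hg
  have hmem : ∀ σ, φ σ ∈ Ann f ↔ σ ∈ Ann g := by
    intro σ
    rw [mem_Ann_iff, mem_Ann_iff]
    constructor
    · intro h1 τ
      rw [h, map_mul, ← mul_assoc]
      exact h1 _
    · intro h1 τ
      have h2 := h1 (φ.symm (↑s⁻¹ * τ))
      rwa [h, map_mul, AlgEquiv.apply_symm_apply, ← mul_assoc, ← mul_assoc, Units.mul_inv,
        one_mul] at h2
  refine ⟨(Ideal.quotientEquivAlg (Ann g) (Ann f) φ ?_).symm⟩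
  ext σ
  rw [← φ.apply_symm_apply σ, hmem]
  constructor
  · intro h1
    exact Ideal.mem_map_of_mem _ h1
  · intro h1
    obtain ⟨x, hx, hxσ⟩ := (Ideal.mem_map_iff_of_surjective (φ : S k n →+* S k n)
      φ.surjective).mp h1
    rwa [← φ.injective hxσ]

/-! ### The tangent space and motion along the orbit -/

/-- The derivation `∑ i, τ i ∂ᵢ` of `S`. -/
noncomputable def vectorField (τ : Fin n → S k n) : Derivation k (S k n) (S k n) :=
  ∑ i, τ i • pderiv k i

theorem vectorField_apply (τ : Fin n → S k n) (σ : S k n) :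
    vectorField τ σ = ∑ i, τ i * pderiv k i σ := by
  rw [vectorField, ← Derivation.coeFnAddMonoidHom_apply, map_sum, Finset.sum_apply]
  rfl

theorem pderiv_mem_mS_pow (i : Fin n) {j : ℕ} {σ : S k n} (hσ : σ ∈ mS k n ^ (j + 1)) :
    pderiv k i σ ∈ mS k n ^ j := by
  rw [mem_mS_pow_iff] at hσ ⊢
  intro a ha
  rw [coeff_pderiv, hσ _ (by simpa using ha), zero_mul]

theorem vectorField_raisesOrder {τ : Fin n → S k n} (hτ : ∀ i, τ i ∈ mS k n ^ 2) :
    RaisesOrder (vectorField τ : S k n →ₗ[k] S k n) := by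
  intro j σ hσ
  rw [Derivation.coeFn_coe, vectorField_apply]
  refine Ideal.sum_mem _ fun i _ => ?_
  cases j with
  | zero =>
    exact Ideal.mul_mem_right _ _ (Ideal.pow_le_pow_right (by omega) (hτ i))
  | succ j =>
    rw [show j + 1 + 1 = 2 + j by ring, pow_add]
    exact Ideal.mul_mem_mul (hτ i) (pderiv_mem_mS_pow i hσ)

/-- The tangent space to the orbit of `f`: functionals `σ ↦ ⟨s σ + ∑ i, τ i ∂ᵢ σ, f⟩` with
`s ∈ 𝔪` and `τ i ∈ 𝔪²`. -/
def tangentSpace (f : P k n) : Submodule k (P k n) where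
  carrier := {h | ∃ s ∈ mS k n, ∃ τ : Fin n → S k n, (∀ i, τ i ∈ mS k n ^ 2) ∧
    ∀ σ, pairing σ h = pairing (s * σ + vectorField τ σ) f}
  zero_mem' := ⟨0, zero_mem _, 0, fun i => zero_mem _, fun σ => by
    simp [vectorField_apply, pairing]⟩
  add_mem' := by
    rintro g h ⟨s, hs, τ, hτ, hg⟩ ⟨s', hs', τ', hτ', hh⟩
    refine ⟨s + s', add_mem hs hs', τ + τ', fun i => add_mem (hτ i) (hτ' i), fun σ => ?_⟩
    rw [pairing_add_right, hg, hh, ← pairingLeft_apply, ← pairingLeft_apply, ← pairingLeft_apply,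
      ← map_add]
    congr 1
    simp only [vectorField_apply, Pi.add_apply, add_mul, Finset.sum_add_distrib]
    ring
  smul_mem' := by
    rintro c h ⟨s, hs, τ, hτ, hh⟩
    refine ⟨c • s, Submodule.smul_of_tower_mem _ c hs, c • τ,
      fun i => Submodule.smul_of_tower_mem _ c (hτ i), fun σ => ?_⟩
    have h1 : pairing σ (c • h) = c * pairing σ h := by
      simp only [pairing]
      rw [Finsupp.sum_smul_index (by simp), Finsupp.mul_sum]
      exact Finsupp.sum_congr fun a _ => by ring
    rw [h1, hh, ← pairingLeft_apply, ← pairingLeft_apply, ← smul_eq_mul, ← map_smul]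
    congr 1
    simp only [vectorField_apply, Pi.smul_apply, smul_add, Finset.smul_sum, smul_mul_assoc]

/-- Every functional on `P` is the pairing with a power series. -/
theorem exists_pairing_eq_dual (ℓ : P k n →ₗ[k] k) : ∃ σ : S k n, ∀ f, pairing σ f = ℓ f := by
  obtain ⟨σ, hσ⟩ : ∃ σ : S k n, ∀ a, coeff a σ = ℓ (Finsupp.single a 1) :=
    ⟨fun a => ℓ (Finsupp.single a 1), fun a => rfl⟩
  refine ⟨σ, fun f => ?_⟩
  induction f using Finsupp.induction_linear with
  | zero => simp [pairing]
  | add f g hf hg => rw [pairing_add_right, hf, hg, map_add]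
  | single a c =>
    rw [pairing_single, hσ, mul_comm, ← smul_eq_mul, ← map_smul, Finsupp.smul_single_one]

theorem mem_tangentSpace {f h : P k n} {d t : ℕ} (hfd : VanishesOnPow f (d + 1))
    (hf : ContractsToLinearOnlyIn f (t + 1)) (hchar : ∀ i : ℕ, 1 ≤ i → i ≤ t + 1 → (i : k) ≠ 0)
    (hh : VanishesOnPow h (t + 2)) : h ∈ tangentSpace f := by
  by_contra hnot
  -- A functional separating `h` from the tangent space is the pairing with some `σ ∈ S`; it remains
  -- to show `σ ∈ 𝔪^(t+2)`.
  obtain ⟨ℓ, hℓh, hℓ⟩ := Submodule.exists_le_ker_of_notMem hnot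
  obtain ⟨σ, hσ⟩ := exists_pairing_eq_dual ℓ
  have hperp : ∀ s ∈ mS k n, ∀ τ : Fin n → S k n, (∀ i, τ i ∈ mS k n ^ 2) →
      pairing (s * σ + vectorField τ σ) f = 0 := by
    intro s hs τ hτ
    obtain ⟨g, hg⟩ := exists_pairing_eq (pairingLeft f ∘ₗ
      (LinearMap.mulLeft k s + (vectorField τ : S k n →ₗ[k] S k n))) (d + 1) (fun ρ hρ => by
        refine hfd _ (add_mem (Ideal.mul_mem_left _ _ hρ) ?_)
        exact Ideal.pow_le_pow_right (Nat.le_succ _) (vectorField_raisesOrder hτ _ ρ hρ))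
    have hgT : g ∈ tangentSpace f := ⟨s, hs, τ, hτ, hg⟩
    have := hℓ hgT
    rw [LinearMap.mem_ker, ← hσ, hg] at this
    exact this
  have hunit : σ ∈ mS k n := by
    rw [IsLocalRing.mem_maximalIdeal, mem_nonunits_iff]
    rintro ⟨u, hu⟩
    -- For a unit `σ`, taking `s = τ σ⁻¹` gives `⟨τ, f⟩ = 0` for all `τ ∈ 𝔪²`, so `f` itself would
    -- have degree at most one.
    have h1 : (1 : S k n) ∈ mS k n ^ (t + 1) := hf 1 fun τ hτ => by
      have hτ1 : τ ∈ mS k n := by simpa using Ideal.pow_le_pow_right one_le_two hτ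
      have := hperp (τ * ↑u⁻¹) (Ideal.mul_mem_right _ _ hτ1) 0 fun i => zero_mem _
      rw [← hu, vectorField_apply, mul_assoc, Units.inv_mul] at this
      simpa using this
    have h2 := mem_mS_pow_iff.mp h1 0 (by simp)
    simp at h2
  -- Testing with `s = 0` and the vector field `τ ∂ᵢ` shows that `∂ᵢσ ⌟ f` has degree at most one.
  have hpd : ∀ i, pderiv k i σ ∈ mS k n ^ (t + 1) := fun i => hf _ fun τ hτ => by
    have := hperp 0 (zero_mem _) (Pi.single i τ) fun j => by
      by_cases hji : j = i
      · subst hji; rwa [Pi.single_eq_same]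
      · rw [Pi.single_eq_of_ne hji]; exact zero_mem _
    rwa [zero_mul, zero_add, vectorField_apply, Finset.sum_eq_single i, Pi.single_eq_same] at this
    · intro j _ hji
      rw [Pi.single_eq_of_ne hji, zero_mul]
    · simp
  refine hℓh ?_
  rw [← hσ]
  refine hh σ (mem_mS_pow_iff.mpr fun a ha => ?_)
  by_cases ha0 : a = 0
  · subst ha0
    rw [coeff_zero_eq_constantCoeff_apply]
    exact mem_mS_iff.mp hunit
  · obtain ⟨i, hi⟩ := Finsupp.ne_iff.mp ha0
    rw [Finsupp.zero_apply] at hi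
    obtain ⟨b, rfl⟩ : ∃ b, a = b + Finsupp.single i 1 := ⟨a - Finsupp.single i 1,
      (tsub_add_cancel_of_le (by rw [Finsupp.single_le_iff]; omega)).symm⟩
    have hdeg : b.degree + 1 < t + 2 := by simpa using ha
    have h1 := mem_mS_pow_iff.mp (hpd i) b (by omega)
    rw [coeff_pderiv] at h1
    have hbi : b i ≤ b.degree := Finsupp.le_degree i b
    -- The coefficient of `∂ᵢσ` at `b` is `bᵢ + 1` times that of `σ` at `b + eᵢ`, and `bᵢ + 1 ≤ t +
    -- 1` is invertible.
    have h2 : (b i : k) + 1 ≠ 0 := by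
      exact_mod_cast hchar (b i + 1) (by omega) (by omega)
    exact (mul_eq_zero.mp h1).resolve_right h2

/-- Moving `f` along a tangent vector `h` changes it by `h` up to terms of lower degree. -/
theorem exists_mem_orbitPlus_of_mem_tangentSpace {f h : P k n} {d e : ℕ}
    (hd : (d.factorial : k) ≠ 0) (hd1 : 1 ≤ d) (hfd : VanishesOnPow f (d + 1))
    (hh : h ∈ tangentSpace f) (hhe : VanishesOnPow h (e + 1)) :
    ∃ g ∈ orbitPlus f, VanishesOnPow (f + h - g) e := by
  obtain ⟨s, hs, τ, hτ, hT⟩ := hh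
  obtain ⟨hr, L, hL, hLE⟩ :=
    exists_gPlus_sub_truncExp_mem s hs (vectorField τ) (vectorField_raisesOrder hτ) hd
  set M : S k n →ₗ[k] S k n := LinearMap.mulLeft k s + (vectorField τ : S k n →ₗ[k] S k n)
  have hTM : ∀ σ, pairing (M σ) f = pairing σ h := fun σ => (hT σ).symm
  have hLp : ∀ σ, pairing (L σ) f = pairing (truncExp d M σ) f := by
    intro σ
    have := hfd _ (hLE σ)
    rwa [← pairingLeft_apply, map_sub, sub_eq_zero] at this
  obtain ⟨g, hg⟩ := exists_pairing_eq (pairingLeft f ∘ₗ (L : S k n →ₗ[k] S k n)) (d + 1)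
    fun ρ hρ => (hLp ρ).trans (hfd _ (truncExp_map_mem_pow hr d hρ))
  refine ⟨g, ⟨L, hL, hg⟩, fun σ hσ => ?_⟩
  obtain ⟨d, rfl⟩ := Nat.exists_eq_add_of_le' hd1
  have h1 : pairing σ g = pairing σ f + pairing σ h := by
    rw [hg]
    change pairing (L σ) f = _
    rw [hLp, truncExp_apply, Finset.sum_range_succ', Finset.sum_range_succ', ← pairingLeft_apply,
      map_add, map_add, map_sum, Finset.sum_eq_zero]
    · simp [hTM, add_comm]
    -- From the quadratic term on, `⟨M^(i+2) σ, f⟩ = ⟨M^(i+1) σ, h⟩`, and `M^(i+1) σ ∈ 𝔪^(e+1)`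
    -- pairs to zero with `h`.
    · intro i _
      rw [map_smul, pairingLeft_apply, pow_succ', Module.End.mul_apply, hTM,
        hhe _ (Ideal.pow_le_pow_right (by omega) (hr.pow (i + 1) hσ)), smul_zero]
  have h2 : pairing σ (f + h - g) + pairing σ g = pairing σ (f + h) := by
    rw [← pairing_add_right, sub_add_cancel]
  rw [pairing_add_right, h1] at h2
  exact add_eq_right.mp h2

theorem add_mem_orbitPlus {d t : ℕ} (hd : (d.factorial : k) ≠ 0) (htd : t + 1 ≤ d) (e : ℕ)
    (het : e ≤ t + 2) {f h : P k n} (hfd : VanishesOnPow f (d + 1))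
    (hf : ContractsToLinearOnlyIn f (t + 1)) (hh : VanishesOnPow h e) :
    f + h ∈ orbitPlus f := by
  induction e generalizing f h with
  | zero =>
    have : h = 0 := eq_of_pairing_eq fun σ => by rw [hh σ (by simp)]; simp [pairing]
    rw [this, add_zero]
    exact ⟨1, one_mem _, fun σ => rfl⟩
  | succ e ih =>
    have hchar : ∀ i : ℕ, 1 ≤ i → i ≤ t + 1 → (i : k) ≠ 0 := fun i h1 h2 h0 => hd <| by
      obtain ⟨c, hc⟩ := Nat.dvd_factorial h1 (h2.trans htd)
      rw [hc, Nat.cast_mul, h0, zero_mul]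
    have hT := mem_tangentSpace hfd hf hchar
      (h := h) fun σ hσ => hh σ (Ideal.pow_le_pow_right het hσ)
    obtain ⟨g, hg, hge⟩ :=
      exists_mem_orbitPlus_of_mem_tangentSpace hd (by omega) hfd hT hh
    -- The induction hypothesis is applied at the new base point `g`, with the error `f + h - g` as
    -- the perturbation.
    have := ih (by omega) (hfd.of_mem_orbitPlus hg) (hf.of_mem_orbitPlus hg) hge
    rw [add_sub_cancel] at this
    exact orbitPlus_trans hg this

/-! ### Consequences of compressedness -/

theorem mem_mQuot_pow_iff {I : Ideal (S k n)} {i : ℕ} {σ : S k n} :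
    Ideal.Quotient.mk I σ ∈ mQuot I ^ i ↔ ∃ ρ ∈ mS k n ^ i, σ - ρ ∈ I := by
  rw [mQuot, ← Ideal.map_pow, Ideal.mem_map_iff_of_surjective _ Ideal.Quotient.mk_surjective]
  simp only [Ideal.Quotient.eq]
  constructor
  · rintro ⟨ρ, h1, h2⟩; exact ⟨ρ, h1, by rw [← neg_sub]; exact neg_mem h2⟩
  · rintro ⟨ρ, h1, h2⟩; exact ⟨ρ, h1, by rw [← neg_sub]; exact neg_mem h2⟩

/-- The projection of `𝔪^i` to the `i`-th graded piece of `S / I`. -/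
noncomputable def gradedMk (I : Ideal (S k n)) (i : ℕ) : ↥(mS k n ^ i) →ₗ[k]
    (↥(mQuot I ^ i) ⧸ (mQuot I ^ (i + 1)).submoduleOf (mQuot I ^ i)) where
  toFun σ := Submodule.Quotient.mk ⟨Ideal.Quotient.mk I σ,
    mem_mQuot_pow_iff.mpr ⟨σ, σ.2, by rw [sub_self]; exact zero_mem _⟩⟩
  map_add' σ τ := rfl
  map_smul' c σ := rfl

theorem gradedMk_surjective (I : Ideal (S k n)) (i : ℕ) :
    Function.Surjective (gradedMk I i) := by
  intro x
  obtain ⟨⟨y, hy⟩, rfl⟩ := Submodule.Quotient.mk_surjective _ x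
  obtain ⟨σ, rfl⟩ := Ideal.Quotient.mk_surjective y
  obtain ⟨ρ, hρ, hσρ⟩ := mem_mQuot_pow_iff.mp hy
  refine ⟨⟨ρ, hρ⟩, ?_⟩
  change Submodule.Quotient.mk _ = _
  congr 2
  exact (Ideal.Quotient.eq.mpr hσρ).symm

theorem gradedMk_eq_zero_iff {I : Ideal (S k n)} {i : ℕ} {σ : ↥(mS k n ^ i)} :
    gradedMk I i σ = 0 ↔ ∃ ρ ∈ mS k n ^ (i + 1), (σ : S k n) - ρ ∈ I := by
  rw [← mem_mQuot_pow_iff]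
  exact Submodule.Quotient.mk_eq_zero _

theorem mem_finsuppAntidiag_univ_iff {i : ℕ} {a : Fin n →₀ ℕ} :
    a ∈ Finset.univ.finsuppAntidiag i ↔ a.degree = i := by
  rw [Finset.mem_finsuppAntidiag, Finsupp.degree_eq_sum]
  simp

variable (k n) in
/-- The homogeneous forms of degree `i`, as elements of `𝔪^i`. -/
noncomputable def homogeneousForm (i : ℕ) :
    ((Finset.univ : Finset (Fin n)).finsuppAntidiag i → k) →ₗ[k] ↥(mS k n ^ i) where
  toFun c := ⟨fun a => if h : a ∈ Finset.univ.finsuppAntidiag i then c ⟨a, h⟩ else 0, by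
    refine mem_mS_pow_iff.mpr fun a ha => ?_
    exact dif_neg fun h => by rw [mem_finsuppAntidiag_univ_iff] at h; omega⟩
  map_add' c c' := by
    ext a
    change (if h : a ∈ Finset.univ.finsuppAntidiag i then (c + c') ⟨a, h⟩ else 0) =
      (if h : a ∈ Finset.univ.finsuppAntidiag i then c ⟨a, h⟩ else 0) +
      (if h : a ∈ Finset.univ.finsuppAntidiag i then c' ⟨a, h⟩ else 0)
    split_ifs <;> simp
  map_smul' r c := by
    ext a
    change (if h : a ∈ Finset.univ.finsuppAntidiag i then (r • c) ⟨a, h⟩ else 0) =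
      r * (if h : a ∈ Finset.univ.finsuppAntidiag i then c ⟨a, h⟩ else 0)
    split_ifs <;> simp

theorem coeff_homogeneousForm {i : ℕ}
    (c : (Finset.univ : Finset (Fin n)).finsuppAntidiag i → k) (a : Fin n →₀ ℕ) :
    coeff a (homogeneousForm k n i c : S k n) =
      if h : a ∈ Finset.univ.finsuppAntidiag i then c ⟨a, h⟩ else 0 := rfl

/-- If `H_{S/I}(i) = H_S(i)`, then `I` contains no power series of order `i`. -/
theorem mem_pow_succ_of_hilbertFunction_eq {I : Ideal (S k n)} {i : ℕ}
    (hH : hilbertFunction I i = (i + n - 1).choose i) {σ ρ : S k n} (hσ : σ ∈ mS k n ^ i)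
    (hρ : ρ ∈ mS k n ^ (i + 1)) (h : σ - ρ ∈ I) : σ ∈ mS k n ^ (i + 1) := by
  let T := (Finset.univ : Finset (Fin n)).finsuppAntidiag i
  let lead : ↥(mS k n ^ i) → T → k := fun τ a => coeff a.1 (τ : S k n)
  let G := gradedMk I i ∘ₗ homogeneousForm k n i
  have hsub : ∀ τ : ↥(mS k n ^ i),
      (τ : S k n) - homogeneousForm k n i (lead τ) ∈ mS k n ^ (i + 1) := by
    intro τ
    rw [mem_mS_pow_iff]
    intro a ha
    rw [map_sub, coeff_homogeneousForm]
    split_ifs with h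
    · exact sub_self _
    · rw [mem_finsuppAntidiag_univ_iff] at h
      rw [sub_zero]
      exact mem_mS_pow_iff.mp τ.2 a (by omega)
  have hG : ∀ τ, G (lead τ) = gradedMk I i τ := by
    intro τ
    symm
    rw [← sub_eq_zero, LinearMap.comp_apply, ← map_sub, gradedMk_eq_zero_iff]
    exact ⟨_, hsub τ, by rw [Submodule.coe_sub, sub_self]; exact zero_mem _⟩
  have hGs : Function.Surjective G := by
    intro x
    obtain ⟨τ, rfl⟩ := gradedMk_surjective I i x
    exact ⟨lead τ, hG τ⟩
  have : FiniteDimensional k (↥(mQuot I ^ i) ⧸ (mQuot I ^ (i + 1)).submoduleOf (mQuot I ^ i)) :=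
    Module.Finite.of_surjective G hGs
  have hdim : Module.finrank k (T → k) = Module.finrank k
      (↥(mQuot I ^ i) ⧸ (mQuot I ^ (i + 1)).submoduleOf (mQuot I ^ i)) := by
    change _ = hilbertFunction I i
    rw [hH, Module.finrank_fintype_fun_eq_card, Fintype.card_coe,
      Finset.card_finsuppAntidiag_nat_eq_choose, Finset.card_univ, Fintype.card_fin, add_comm]
  -- Forms of degree `i` surject onto the graded piece; equality of dimensions makes this map
  -- injective.
  have hGi : Function.Injective G :=
    (LinearMap.injective_iff_surjective_of_finrank_eq_finrank hdim).mpr hGs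
  have h0 : G (lead ⟨σ, hσ⟩) = 0 := by
    rw [hG, gradedMk_eq_zero_iff]
    exact ⟨ρ, hρ, h⟩
  have h1 : lead ⟨σ, hσ⟩ = 0 := hGi (by rw [h0, map_zero])
  simpa [h1] using hsub ⟨σ, hσ⟩

theorem sub_C_mem_mS (ρ : S k n) : ρ - C (constantCoeff ρ) ∈ mS k n := by
  rw [mem_mS_iff, map_sub, constantCoeff_C, sub_self]

theorem pairing_C_mul (c : k) (σ : S k n) (f : P k n) :
    pairing (C c * σ) f = c * pairing σ f := by
  rw [← smul_eq_C_mul, ← pairingLeft_apply, map_smul]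
  rfl

theorem pairing_add_left (σ τ : S k n) (f : P k n) :
    pairing (σ + τ) f = pairing σ f + pairing τ f := (pairingLeft f).map_add σ τ

theorem pairing_sub_left (σ τ : S k n) (f : P k n) :
    pairing (σ - τ) f = pairing σ f - pairing τ f := (pairingLeft f).map_sub σ τ

theorem pairing_mul_eq (ρ σ : S k n) (f : P k n) : pairing (ρ * σ) f =
    constantCoeff ρ * pairing σ f + pairing ((ρ - C (constantCoeff ρ)) * σ) f := by
  rw [← pairing_C_mul, ← pairing_add_left]
  congr 1
  ring

/-- If `τ ⌟ f` has degree at most one and no linear part, then it is constant. -/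
theorem pairing_mul_eq_zero_of_mem_mS {f : P k n} {τ : S k n}
    (h2 : ∀ ρ ∈ mS k n ^ 2, pairing (ρ * τ) f = 0) (h1 : ∀ i, pairing (X i * τ) f = 0)
    {ρ : S k n} (hρ : ρ ∈ mS k n) : pairing (ρ * τ) f = 0 := by
  rw [← sum_X_mul_divFirst (mem_mS_iff.mp hρ), Finset.sum_mul, ← pairingLeft_apply, map_sum]
  refine Finset.sum_eq_zero fun i _ => ?_
  rw [pairingLeft_apply, mul_right_comm, mul_comm, pairing_mul_eq, h1, mul_zero, zero_add,
    ← mul_assoc]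
  refine h2 _ ?_
  rw [pow_two]
  exact Ideal.mul_mem_mul (sub_C_mem_mS _) (X_mem_mS i)

theorem exists_degree_eq_deg {f : P k n} (hf : f ≠ 0) : ∃ a, a.degree = deg f ∧ f a ≠ 0 := by
  obtain ⟨a, ha, h⟩ := Finset.exists_mem_eq_sup f.support (Finsupp.support_nonempty_iff.mpr hf)
    Finsupp.degree
  exact ⟨a, h.symm, Finsupp.mem_support_iff.mp ha⟩

theorem vanishesOnPow_deg (f : P k n) : VanishesOnPow f (deg f + 1) := fun _ hσ =>
  pairing_eq_zero_of_mem (fun _ ha => Finset.le_sup (f := Finsupp.degree) ha) hσ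

/-- If `τ ⌟ f` is constant, then it is the contraction of `f` with an element of `𝔪^(deg f)`. -/
theorem exists_sub_mem_Ann {f : P k n} (hf : f ≠ 0) {τ : S k n}
    (h : ∀ ρ ∈ mS k n, pairing (ρ * τ) f = 0) : ∃ δ ∈ mS k n ^ deg f, τ - δ ∈ Ann f := by
  obtain ⟨a, ha, hfa⟩ := exists_degree_eq_deg hf
  -- A multiple of a top-degree monomial of `f`, scaled so that it has the same pairing with `f` as
  -- `τ`.
  have hδ : C (pairing τ f / f a) * monomial a 1 ∈ mS k n ^ deg f :=
    Ideal.mul_mem_left _ _ (monomial_mem_mS_pow a 1 ha.ge)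
  refine ⟨_, hδ, mem_Ann_iff.mpr fun ρ => ?_⟩
  have h1 := sub_C_mem_mS ρ
  have h2 := vanishesOnPow_deg f _ (by rw [pow_succ']; exact Ideal.mul_mem_mul h1 hδ)
  rw [mul_sub, pairing_sub_left, pairing_mul_eq ρ τ, h _ h1, pairing_mul_eq ρ, h2, pairing_C_mul,
    pairing_monomial, div_mul_cancel₀ _ hfa, sub_self]

theorem isSocleDegree_Ann {f : P k n} (hf : f ≠ 0) : IsSocleDegree (Ann f) (deg f) := by
  constructor
  · intro h0
    obtain ⟨a, ha, hfa⟩ := exists_degree_eq_deg hf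
    have h1 : Ideal.Quotient.mk (Ann f) (monomial a 1) ∈ mQuot (Ann f) ^ deg f :=
      mem_mQuot_pow_iff.mpr ⟨_, monomial_mem_mS_pow a 1 ha.ge, by
        rw [sub_self]; exact zero_mem _⟩
    rw [h0, Ideal.mem_bot, Ideal.Quotient.eq_zero_iff_mem, mem_Ann_iff] at h1
    exact hfa (by rw [← pairing_monomial, ← h1 1, one_mul])
  · intro i hi
    by_contra hlt
    refine hi ((Submodule.eq_bot_iff _).mpr fun x hx => ?_)
    obtain ⟨σ, rfl⟩ := Ideal.Quotient.mk_surjective x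
    obtain ⟨ρ, hρ, hσρ⟩ := mem_mQuot_pow_iff.mp hx
    rw [Ideal.Quotient.eq.mpr hσρ, Ideal.Quotient.eq_zero_iff_mem, mem_Ann_iff]
    exact fun τ => vanishesOnPow_deg f _
      (Ideal.mul_mem_left _ _ (Ideal.pow_le_pow_right (by omega) hρ))

/-- If `H(d - 1) = n`, then every element of `S ⌟ f` of degree at most one is the contraction
of `f` with an element of `𝔪^(d-1)`. -/
theorem exists_sub_mem_Ann_of_hilbertFunction_eq {f : P k n} {d : ℕ} (hd : deg f = d + 1)
    (hH : hilbertFunction (Ann f) d = n) {σ : S k n}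
    (hσ : ∀ τ ∈ mS k n ^ 2, pairing (τ * σ) f = 0) : ∃ ρ ∈ mS k n ^ d, σ - ρ ∈ Ann f := by
  have hf : f ≠ 0 := by rintro rfl; simp [deg] at hd
  have hvan : VanishesOnPow f (d + 2) := by simpa [hd] using vanishesOnPow_deg f
  have hsq : ∀ ρ ∈ mS k n ^ d, ∀ τ ∈ mS k n ^ 2, pairing (τ * ρ) f = 0 := fun ρ hρ τ hτ =>
    hvan _ (by rw [add_comm, pow_add]; exact Ideal.mul_mem_mul hτ hρ)
  let ev : ↥(mS k n ^ d) →ₗ[k] (Fin n → k) :=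
    { toFun := fun ρ i => pairing (X i * (ρ : S k n)) f
      map_add' := fun ρ ρ' => by
        ext i
        rw [Submodule.coe_add, mul_add, pairing_add_left]
        rfl
      map_smul' := fun c ρ => by
        ext i
        rw [Submodule.coe_smul_of_tower, smul_eq_C_mul, mul_left_comm, pairing_C_mul]
        rfl }
  have hev : ∀ ρ i, ev ρ i = pairing (X i * (ρ : S k n)) f := fun _ _ => rfl
  have hker : LinearMap.ker (gradedMk (Ann f) d) = LinearMap.ker ev := by
    ext ρ
    rw [LinearMap.mem_ker, LinearMap.mem_ker, gradedMk_eq_zero_iff]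
    constructor
    · rintro ⟨δ, hδ, hρδ⟩
      ext i
      have h1 := mem_Ann_iff.mp hρδ (X i)
      have h2 : (X i : S k n) * δ ∈ mS k n ^ (d + 2) := by
        rw [show d + 2 = 1 + (d + 1) by ring, pow_add, pow_one]
        exact Ideal.mul_mem_mul (X_mem_mS i) hδ
      rwa [mul_sub, pairing_sub_left, hvan _ h2, sub_zero] at h1
    · intro h0
      rw [← hd]
      exact exists_sub_mem_Ann hf fun τ hτ => pairing_mul_eq_zero_of_mem_mS (hsq ρ ρ.2)
        (fun i => by rw [← hev, h0, Pi.zero_apply]) hτ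
  -- Since `ev` and `gradedMk` have the same kernel, the range of `ev` has dimension `H(d) = n`:
  -- every linear part occurs.
  have hrange : LinearMap.range ev = ⊤ := by
    refine Submodule.eq_top_of_finrank_eq ?_
    rw [← (LinearMap.quotKerEquivRange ev).finrank_eq,
      ← (Submodule.quotEquivOfEq _ _ hker).finrank_eq,
      ((gradedMk (Ann f) d).quotKerEquivOfSurjective (gradedMk_surjective _ _)).finrank_eq,
      Module.finrank_fin_fun]
    exact hH
  obtain ⟨ρ, hρ⟩ := LinearMap.range_eq_top.mp hrange fun i => pairing (X i * σ) f
  -- The linear parts of `σ ⌟ f` and `ρ ⌟ f` agree, so only a constant remains to be corrected.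
  obtain ⟨δ, hδ, hA⟩ := exists_sub_mem_Ann hf (τ := σ - ρ) fun τ hτ => by
    refine pairing_mul_eq_zero_of_mem_mS (fun τ' hτ' => ?_) (fun i => ?_) hτ
    · rw [mul_sub, pairing_sub_left, hσ _ hτ', hsq ρ ρ.2 _ hτ', sub_zero]
    · rw [mul_sub, pairing_sub_left, ← hev, hρ, sub_self]
  refine ⟨ρ + δ, add_mem ρ.2 (Ideal.pow_le_pow_right (by omega) hδ), ?_⟩
  rwa [← sub_sub]

theorem lt_choose_of_two_le {n d : ℕ} (hn : 2 ≤ n) (hd : 2 ≤ d) : n < (d + n - 1).choose d := by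
  have h1 : (d + n - 1).choose d = (d + n - 1).choose (n - 1) :=
    Nat.choose_symm_of_eq_add (by omega)
  have h2 : (n + 1).choose (n - 1) ≤ (d + n - 1).choose (n - 1) :=
    Nat.choose_le_choose _ (by omega)
  have h3 : (n + 1).choose (n - 1) = (n + 1).choose 2 :=
    Nat.choose_symm_of_eq_add (by omega)
  have h4 : (n + 1).choose 2 = n.choose 1 + n.choose 2 := Nat.choose_succ_succ' n 1
  have h5 : 0 < n.choose 2 := Nat.choose_pos hn
  rw [Nat.choose_one_right] at h4
  omega

theorem IsCompressed.hilbertFunction_deg_sub_one {f : P k n} {t : ℕ} (hf0 : f ≠ 0)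
    (hf : IsCompressed (Ann f) t) : hilbertFunction (Ann f) (deg f - 1) = n := by
  obtain ⟨-, -, d, hd, hHd⟩ := hf
  rwa [IsGreatest.unique hd (isSocleDegree_Ann hf0)] at hHd

/-- If `deg f - 1 ≤ t`, then `H(deg f - 1)` would equal both `n` and the larger number of monomials
of that degree. This needs `n ≥ 2`; for `n = 0` the degree is zero. -/
theorem IsCompressed.add_two_le_deg {f : P k n} {t : ℕ} (hdeg : 3 ≤ deg f)
    (hf : IsCompressed (Ann f) t) (ht : n = 1 → t + 2 ≤ deg f) : t + 2 ≤ deg f := by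
  have hf0 : f ≠ 0 := by rintro rfl; simp [deg] at hdeg
  have hHd := hf.hilbertFunction_deg_sub_one hf0
  by_contra hlt
  have hn0 : n ≠ 0 := by
    rintro rfl
    obtain ⟨a, ha, -⟩ := exists_degree_eq_deg hf0
    rw [Subsingleton.elim a 0, map_zero] at ha
    omega
  have hn : 2 ≤ n := by
    by_contra hn
    exact hlt (ht (by omega))
  have h1 := hf.2.1 (deg f - 1) (by omega)
  have h2 := lt_choose_of_two_le hn (d := deg f - 1) (by omega)
  omega

theorem IsCompressed.contractsToLinearOnlyIn {f : P k n} {t : ℕ} (htd : t + 2 ≤ deg f)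
    (hf : IsCompressed (Ann f) t) : ContractsToLinearOnlyIn f (t + 1) := by
  have hf0 : f ≠ 0 := by rintro rfl; simp [deg] at htd
  obtain ⟨d, hd⟩ : ∃ d, deg f = d + 1 := ⟨deg f - 1, by omega⟩
  have hHd := hf.hilbertFunction_deg_sub_one hf0
  rw [hd, Nat.add_sub_cancel] at hHd
  intro σ hσ
  obtain ⟨ρ, hρ, hA⟩ := exists_sub_mem_Ann_of_hilbertFunction_eq hd hHd hσ
  -- The order of `σ` climbs one step at a time: `σ ≡ ρ` modulo `Ann f`, with `ρ ∈ 𝔪^d` and `d ≥ t +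
  -- 1`, so `H(j)` being maximal rules out a leading form of degree `j`.
  have key : ∀ j ≤ t + 1, σ ∈ mS k n ^ j := by
    intro j
    induction j with
    | zero => simp
    | succ j ih =>
      intro hj
      exact mem_pow_succ_of_hilbertFunction_eq (hf.2.1 j (by omega)) (ih (by omega))
        (Ideal.pow_le_pow_right (by omega) hρ) hA
  exact key _ le_rfl

theorem cast_factorial_ne_zero {d : ℕ} (h : ringChar k = 0 ∨ d < ringChar k) :
    (d.factorial : k) ≠ 0 := by
  rw [Ne, ringChar.spec]
  rcases h with h | h
  · rw [h, zero_dvd_iff]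
    exact d.factorial_ne_zero
  · have hp : (ringChar k).Prime :=
      (CharP.char_is_prime_or_zero k (ringChar k)).resolve_right (by omega)
    rw [hp.dvd_factorial]
    omega

end Apolarity

theorem mainTheorem4 {k : Type*} [Field k] [IsAlgClosed k] {n : ℕ}
    (f : Apolarity.P k n) (t : ℕ)
    (hchar : ringChar k = 0 ∨ Apolarity.deg f < ringChar k)
    (hdeg : 3 ≤ Apolarity.deg f)
    (hf : Apolarity.IsCompressed (Apolarity.Ann f) t)
    (ht : n = 1 → t + 2 ≤ Apolarity.deg f) :
    (∀ h ∈ Apolarity.PLE k n (t + 1), f + h ∈ Apolarity.orbitPlus f) ∧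
      Apolarity.partGE (t + 2) f ∈ Apolarity.orbitPlus f ∧
      Nonempty (Apolarity.Apolar f ≃ₐ[k] Apolarity.Apolar (Apolarity.partGE (t + 2) f)) := by
  have htd := hf.add_two_le_deg hdeg ht
  have h1 : ∀ h ∈ Apolarity.PLE k n (t + 1), f + h ∈ Apolarity.orbitPlus f := fun h hh =>
    Apolarity.add_mem_orbitPlus (Apolarity.cast_factorial_ne_zero hchar) (by omega) (t + 2) le_rfl
      (Apolarity.vanishesOnPow_deg f) (hf.contractsToLinearOnlyIn htd)
      fun σ hσ => Apolarity.pairing_eq_zero_of_mem hh hσ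
  have h2 : Apolarity.partGE (t + 2) f ∈ Apolarity.orbitPlus f := by
    -- The perturbation is minus the part of `f` of degree at most `t + 1`.
    have h3 := h1 (-f.filter fun a => ¬ t + 2 ≤ a.degree) (neg_mem fun a ha => by
      have := (Finsupp.mem_support_iff.mp ha)
      rw [Set.mem_ofPred_eq]
      by_contra hlt
      exact this (Finsupp.filter_apply_neg _ _ (by omega)))
    rwa [← sub_eq_add_neg, sub_eq_of_eq_add
      (Finsupp.filter_add_filter_not f fun a => t + 2 ≤ a.degree).symm] at h3
  exact ⟨h1, h2, Apolarity.apolar_algEquiv_of_mem_orbitPlus h2⟩
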